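/- Let $(M,g)$ be a smooth Riemannian manifold of dimension $m$ (without boundary), and let $\phi:M\to\mathbb C$ be a smooth complex-valued function. Let $\nabla\phi=\nabla(\operatorname{Re}\phi)+i\,\nabla(\operatorname{Im}\phi)$ be its complexified gradient, let $\tau(\phi)=\operatorname{div}(\nabla\phi)$ be the (complex linear) Laplace–Beltrami operator, and let $\kappa(\phi,\psi)=g(\nabla\phi,\nabla\psi)$, where $g$ is extended to a complex bilinear form. Suppose that $\phi$ is an eigenfunction, i.e. there are constants $\lambda,\mu\in\mathbb C$ such that $$\tau(\phi)=\lambda\,\phi\quad\text{and}\quad\kappa(\phi,\phi)=\mu\,\phi^2\quad\text{on } M,$$ and that $0\in\phi(M)$ is a regular value of $\phi$, i.e. $d\phi_p:T_pM\to\mathbb C$ is surjective for every $p\in\phi^{-1}(\{0\})$. Then the fibre $\phi^{-1}(\{0\})$ is an embedded submanifold of $M$ of codimension two, and it is minimal, i.e. its mean curvature vector vanishes at every point. -/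

import Mathlib

open Set Filter Topology Bundle
open scoped Manifold ContDiff

noncomputable section

/-- The model space `ℝ^m`. -/
abbrev Eu (m : ℕ) : Type := EuclideanSpace ℝ (Fin m)

/-- A smooth Riemannian metric on a smooth manifold `M` of dimension `m` (without boundary). -/
abbrev SmoothMetric (m : ℕ) (M : Type*) [TopologicalSpace M] [ChartedSpace (Eu m) M]
    [IsManifold (𝓡 m) ∞ M] :=
  ContMDiffRiemannianMetric (𝓡 m) ∞ (Eu m) (fun x : M => TangentSpace (𝓡 m) x)

/-- A (not necessarily continuous) vector field on `M`. -/
abbrev VField (m : ℕ) (M : Type*) [TopologicalSpace M] [ChartedSpace (Eu m) M] :=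
  (x : M) → TangentSpace (𝓡 m) x

section Geometry

variable {m : ℕ} {M : Type*} [TopologicalSpace M] [ChartedSpace (Eu m) M]

/-- The coordinate vector `∂/∂x_i` of the chart `e`, at the point with coordinates `y`. -/
def coordVector (e : OpenPartialHomeomorph M (Eu m)) (i : Fin m) (y : Eu m) :
    TangentSpace (𝓡 m) (e.symm y) :=
  mfderiv (𝓡 m) (𝓡 m) e.symm y (EuclideanSpace.single i (1 : ℝ) : Eu m)

/-- The components of the vector field `X` in the chart `e`, as a function of the coordinates. -/
def fieldInChart (e : OpenPartialHomeomorph M (Eu m)) (X : VField m M) (y : Eu m) : Eu m :=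
  mvfderiv (𝓡 m) e (e.symm y) (X (e.symm y))

/-- `c` is a regular value of `φ`: the differential is onto at each point of the fibre over `c`. -/
def IsRegularValue (φ : M → ℂ) (c : ℂ) : Prop :=
  ∀ p, φ p = c → Function.Surjective (mvfderiv (𝓡 m) φ p)

variable [IsManifold (𝓡 m) ∞ M]

/-! ### Submanifolds and their tangent vectors -/

/-- The vector field `X` is smooth on the set `U`. -/
def SmoothFieldOn (X : VField m M) (U : Set M) : Prop :=
  ContMDiffOn (𝓡 m) (𝓡 m).tangent ∞ (fun x => (⟨x, X x⟩ : TangentBundle (𝓡 m) M)) U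

/-- `K` is an embedded smooth submanifold of `M` of dimension `k`: around each of its points there is
a chart of the smooth atlas of `M` that maps `K` to a `k`-dimensional linear subspace of `ℝ^m`. -/
def IsEmbeddedSubmanifold (K : Set M) (k : ℕ) : Prop :=
  ∀ p ∈ K, ∃ e ∈ IsManifold.maximalAtlas (𝓡 m) ∞ M, p ∈ e.source ∧
    ∃ S : Submodule ℝ (Eu m), Module.finrank ℝ S = k ∧ ∀ x ∈ e.source, x ∈ K ↔ e x ∈ S

/-- `v` is tangent to `K` at `p`: it is the velocity at time `0` of a smooth curve in `M` that starts
at `p` and stays in `K` for small times. -/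
def IsTangentTo (K : Set M) (p : M) (v : TangentSpace (𝓡 m) p) : Prop :=
  ∃ γ : ℝ → M, ContMDiff 𝓘(ℝ, ℝ) (𝓡 m) ∞ γ ∧ (∀ᶠ t in 𝓝 (0 : ℝ), γ t ∈ K) ∧
    (⟨γ 0, mfderiv 𝓘(ℝ, ℝ) (𝓡 m) γ 0 (1 : ℝ)⟩ : TangentBundle (𝓡 m) M) = ⟨p, v⟩

/-- `X` is a vector field on `M`, smooth near `p`, that is tangent to `K` along `K` near `p`. -/
def IsTangentFieldNear (K : Set M) (p : M) (X : VField m M) : Prop :=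
  ∃ U : Set M, IsOpen U ∧ p ∈ U ∧ SmoothFieldOn X U ∧ ∀ q ∈ U ∩ K, IsTangentTo K q (X q)

/-! ### The metric and its Levi-Civita connection in a chart -/

/-- The matrix `g_{ij}` of the metric in the chart `e`, as a function of the coordinates. -/
def gramMatrix (g : SmoothMetric m M) (e : OpenPartialHomeomorph M (Eu m)) (y : Eu m) :
    Matrix (Fin m) (Fin m) ℝ :=
  Matrix.of fun i j => g.inner (e.symm y) (coordVector e i y) (coordVector e j y)

/-- The derivative `∂g_{jl}/∂x_i` in the chart `e`. -/
def gramDeriv (g : SmoothMetric m M) (e : OpenPartialHomeomorph M (Eu m)) (y : Eu m)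
    (i j l : Fin m) : ℝ :=
  fderiv ℝ (fun z => gramMatrix g e z j l) y (EuclideanSpace.single i (1 : ℝ))

/-- The Christoffel symbol `Γ^k_{ij} = ½ ∑_l g^{kl} (∂_i g_{jl} + ∂_j g_{il} - ∂_l g_{ij})`. -/
def christoffel (g : SmoothMetric m M) (e : OpenPartialHomeomorph M (Eu m)) (y : Eu m)
    (k i j : Fin m) : ℝ :=
  (1 / 2 : ℝ) * ∑ l, (gramMatrix g e y)⁻¹ k l *
    (gramDeriv g e y i j l + gramDeriv g e y j i l - gramDeriv g e y l i j)

/-- The covariant derivative in coordinates: for a vector field with components `X`, the linear map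
sending `v` to the vector with `k`-th component `v(X^k) + ∑_{i,j} Γ^k_{ij} v^i X^j`. -/
def covDerivInChart (g : SmoothMetric m M) (e : OpenPartialHomeomorph M (Eu m)) (X : Eu m → Eu m)
    (y : Eu m) : Eu m →ₗ[ℝ] Eu m :=
  (fderiv ℝ X y).toLinearMap +
    Matrix.toEuclideanLin (Matrix.of fun k i : Fin m => ∑ j, christoffel g e y k i j * X y j)

/-- The Levi-Civita connection: `leviCivita g X p v` is `∇_v X` at `p`, computed in the chart of `M`
at `p`. -/
def leviCivita (g : SmoothMetric m M) (X : VField m M) (p : M) :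
    TangentSpace (𝓡 m) p →ₗ[ℝ] TangentSpace (𝓡 m) p :=
  let e := chartAt (Eu m) p
  let dx : TangentSpace (𝓡 m) p →L[ℝ] Eu m := mvfderiv (𝓡 m) e p
  dx.inverse.toLinearMap ∘ₗ covDerivInChart g e (fieldInChart e X) (e p) ∘ₗ dx.toLinearMap

/-! ### Gradient, divergence, Laplace-Beltrami operator, conformality operator -/

theorem exists_gradient (g : SmoothMetric m M) (u : M → ℝ) (p : M) :
    ∃ w : TangentSpace (𝓡 m) p, ∀ v : TangentSpace (𝓡 m) p,
      g.inner p w v = mvfderiv (𝓡 m) u p v := by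
  let T : Eu m →ₗ[ℝ] Module.Dual ℝ (Eu m) :=
    { toFun := fun w => (g.inner p w).toLinearMap
      map_add' := fun a b => LinearMap.ext fun v =>
        DFunLike.congr_fun (map_add (g.inner p) a b) v
      map_smul' := fun c a => LinearMap.ext fun v =>
        DFunLike.congr_fun (map_smul (g.inner p) c a) v }
  have hinj : Function.Injective T := by
    rw [injective_iff_map_eq_zero]
    intro w hw
    by_contra h
    have h1 := g.pos p w h
    have h2 : g.inner p w w = 0 := LinearMap.congr_fun hw w
    exact h1.ne' h2
  have hsurj : Function.Surjective T :=
    (LinearMap.injective_iff_surjective_of_finrank_eq_finrank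
      (Subspace.dual_finrank_eq (K := ℝ) (V := Eu m)).symm).1 hinj
  obtain ⟨w, hw⟩ := hsurj (mvfderiv (𝓡 m) u p).toLinearMap
  exact ⟨w, fun v => LinearMap.congr_fun hw v⟩

/-- The gradient of `u`, i.e. the vector field with `g(∇u, v) = du(v)` for all `v`. -/
def grad (g : SmoothMetric m M) (u : M → ℝ) : VField m M :=
  fun p => (exists_gradient g u p).choose

/-- The divergence of a vector field, i.e. the trace of `v ↦ ∇_v X`. -/
def divergence (g : SmoothMetric m M) (X : VField m M) (p : M) : ℝ :=
  LinearMap.trace ℝ (TangentSpace (𝓡 m) p) (leviCivita g X p)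

/-- The Laplace-Beltrami operator `τ(φ) = div ∇φ`, extended complex linearly from real-valued to
complex-valued functions. -/
def tension (g : SmoothMetric m M) (φ : M → ℂ) (p : M) : ℂ :=
  (divergence g (grad g fun x => (φ x).re) p : ℂ) +
    Complex.I * (divergence g (grad g fun x => (φ x).im) p : ℂ)

/-- `g(∇u, ∇w)` for real-valued `u` and `w`. -/
def gradInner (g : SmoothMetric m M) (u w : M → ℝ) (p : M) : ℝ :=
  g.inner p (grad g u p) (grad g w p)

/-- The conformality operator `κ(φ, ψ) = g(∇φ, ∇ψ)`, where `∇φ = ∇(Re φ) + i ∇(Im φ)` and `g` is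
extended to a complex bilinear form. -/
def conformality (g : SmoothMetric m M) (φ ψ : M → ℂ) (p : M) : ℂ :=
  ((gradInner g (fun x => (φ x).re) (fun x => (ψ x).re) p : ℂ) -
      (gradInner g (fun x => (φ x).im) (fun x => (ψ x).im) p : ℂ)) +
    Complex.I * ((gradInner g (fun x => (φ x).re) (fun x => (ψ x).im) p : ℂ) +
      (gradInner g (fun x => (φ x).im) (fun x => (ψ x).re) p : ℂ))

/-- `φ` is a smooth complex-valued function with `τ(φ) = lam φ` and `κ(φ, φ) = mu φ²` for some
complex constants `lam`, `mu`. -/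
def IsEigenfunction (g : SmoothMetric m M) (φ : M → ℂ) : Prop :=
  ContMDiff (𝓡 m) 𝓘(ℝ, ℂ) ∞ φ ∧
    ∃ lam mu : ℂ, ∀ p, tension g φ p = lam * φ p ∧ conformality g φ φ p = mu * φ p ^ 2

/-! ### Minimal submanifolds -/

/-- `v` is normal to `K` at `p`, i.e. orthogonal to all tangent vectors of `K` at `p`. -/
def IsNormalTo (g : SmoothMetric m M) (K : Set M) (p : M) (v : TangentSpace (𝓡 m) p) : Prop :=
  ∀ w : TangentSpace (𝓡 m) p, IsTangentTo K p w → g.inner p v w = 0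

/-- The mean curvature of the `k`-dimensional submanifold `K` vanishes at `p`. The second fundamental
form of `K` at `p` sends tangent vectors `X p`, `Y p` to the normal part of `∇_X Y`, where `X`, `Y`
are any smooth local fields tangent to `K` along `K`. Its trace, `k` times the mean curvature vector,
is the normal part of `∑_a ∇_{V_a} V_a` for any such fields `V_1, …, V_k` that are orthonormal
at `p`; so this sum is orthogonal to all normal vectors. -/
def MeanCurvatureVanishesAt (g : SmoothMetric m M) (k : ℕ) (K : Set M) (p : M) : Prop :=
  ∀ V : Fin k → VField m M, (∀ a, IsTangentFieldNear K p (V a)) →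
    (∀ a b, g.inner p (V a p) (V b p) = if a = b then 1 else 0) →
    ∀ v : TangentSpace (𝓡 m) p, IsNormalTo g K p v →
      g.inner p (∑ a, leviCivita g (V a) p (V a p)) v = 0

/-- `K` is a minimal submanifold of dimension `k`: an embedded submanifold whose mean curvature
vanishes at each of its points. -/
def IsMinimalSubmanifold (g : SmoothMetric m M) (k : ℕ) (K : Set M) : Prop :=
  IsEmbeddedSubmanifold (m := m) K k ∧ ∀ p ∈ K, MeanCurvatureVanishesAt g k K p

end Geometry

end

/-!
Write `u = Re φ` and `w = Im φ`. At a zero `p` of `φ` the eigenfunction equations say that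
`Δu = Δw = 0`, that `|∇u|² = |∇w|²` and that `g(∇u, ∇w) = 0`. Since `μ φ²` vanishes to second order on
the fibre, the last two functions even have vanishing first derivative at `p`:
`Hess u (x, ∇u) = Hess w (x, ∇w)` and `Hess u (x, ∇w) + Hess w (x, ∇u) = 0` for all `x`. Taking
`x = ∇u` in the first and `x = ∇w` in the second relation, the symmetry of `Hess w` gives
`Hess u (∇u, ∇u) + Hess u (∇w, ∇w) = 0`. As `∇u` and `∇w` are orthogonal of equal length and span the
normal space, the trace of `Hess u` over the tangent space of the fibre is `Δu = 0`, and likewise for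
`w`; this is the linear algebra of `sum_bilin_eq_zero_of_trace_eq_zero`.

For a field `V` tangent to the fibre, `du(V) = 0` along the fibre, so that
`g(∇_V V, ∇u) = -Hess u (V, V)` (`IsTangentFieldNear.inner_grad_leviCivita`). Summing over an
orthonormal frame, `∑ ∇_V V` is orthogonal to `∇u` and to `∇w`, hence to all normal vectors
(`meanCurvatureVanishesAt_of_horizontally_conformal`).

The Hessian is computed in the chart at `p`. The input is that the Christoffel symbols satisfy the
Koszul formula (`isChristoffelAt_christoffelForm`), from which the symmetry of the covariant
derivative of a gradient and the compatibility of the connection with the metric follow by calculus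
in `ℝ^m`. That the fibre is an embedded submanifold is the regular value theorem
(`isEmbeddedSubmanifold_of_surjective`), proved with the inverse function theorem.
-/

/-! ### Traces and orthonormal frames -/

section LinearAlgebra

variable {E : Type*} [AddCommGroup E] [Module ℝ E]

theorem linearIndependent_of_bilin_orthonormal {ι : Type*} [Finite ι]
    (B : E →ₗ[ℝ] E →ₗ[ℝ] ℝ) {v : ι → E} (horth : Pairwise fun i j => B (v i) (v j) = 0)
    (hne : ∀ i, B (v i) (v i) ≠ 0) : LinearIndependent ℝ v := by
  classical
  have := Fintype.ofFinite ι
  rw [Fintype.linearIndependent_iff]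
  intro c hc i
  have h : B (∑ j, c j • v j) (v i) = c i * B (v i) (v i) := by
    rw [map_sum, LinearMap.sum_apply, Finset.sum_eq_single i]
    · simp
    · intro j _ hj
      simp [horth hj]
    · simp
  rw [hc] at h
  simpa [hne i] using h.symm

/-- In a basis that is orthogonal for `B`, the coordinates are `B (b i) · / B (b i) (b i)`. -/
theorem repr_eq_of_bilin_orthogonal {ι : Type*} [Fintype ι]
    (B : E →ₗ[ℝ] E →ₗ[ℝ] ℝ) (b : Module.Basis ι ℝ E)
    (horth : Pairwise fun i j => B (b i) (b j) = 0) (hne : ∀ i, B (b i) (b i) ≠ 0) (x : E) (i : ι) :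
    b.repr x i = B x (b i) / B (b i) (b i) := by
  classical
  rw [eq_div_iff (hne i)]
  conv_rhs => rw [← b.sum_repr x]
  rw [map_sum, LinearMap.sum_apply, Finset.sum_eq_single i]
  · simp
  · intro j _ hj
    simp [horth hj]
  · simp

theorem trace_eq_sum_of_bilin_orthogonal {ι : Type*} [Fintype ι]
    (B : E →ₗ[ℝ] E →ₗ[ℝ] ℝ) (b : Module.Basis ι ℝ E)
    (horth : Pairwise fun i j => B (b i) (b j) = 0) (hne : ∀ i, B (b i) (b i) ≠ 0)
    (T : E →ₗ[ℝ] E) :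
    LinearMap.trace ℝ E T = ∑ i, B (T (b i)) (b i) / B (b i) (b i) := by
  classical
  rw [LinearMap.trace_eq_matrix_trace ℝ b, Matrix.trace]
  refine Finset.sum_congr rfl fun i _ => ?_
  rw [Matrix.diag_apply, LinearMap.toMatrix_apply, repr_eq_of_bilin_orthogonal B b horth hne]

/-- In dimension `k + 2`, orthonormal vectors `X_1, …, X_k` and two orthogonal vectors `U`, `W` of the
same nonzero length that are orthogonal to them form a basis. -/
theorem exists_orthogonal_basis_extending [FiniteDimensional ℝ E] {k : ℕ}
    (hk : Module.finrank ℝ E = k + 2) (B : E →ₗ[ℝ] E →ₗ[ℝ] ℝ) (hB : ∀ v w, B v w = B w v)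
    {U W : E} {X : Fin k → E} {c : ℝ} (hc : c ≠ 0) (hUU : B U U = c) (hWW : B W W = c)
    (hUW : B U W = 0) (hX : ∀ a b, B (X a) (X b) = if a = b then 1 else 0)
    (hXU : ∀ a, B (X a) U = 0) (hXW : ∀ a, B (X a) W = 0) :
    ∃ b : Module.Basis (Fin k ⊕ Fin 2) ℝ E, (⇑b = Sum.elim X ![U, W]) ∧
      (Pairwise fun i j => B (b i) (b j) = 0) ∧ ∀ i, B (b i) (b i) ≠ 0 := by
  have h1 : Pairwise fun i j => B (Sum.elim X ![U, W] i) (Sum.elim X ![U, W] j) = 0 := by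
    rintro (i | i) (j | j) hij
    · simpa [hX] using fun h => hij (by rw [h])
    · fin_cases j <;> simp [hXU, hXW]
    · fin_cases i <;> simp [hB _ (X j), hXU, hXW]
    · fin_cases i <;> fin_cases j <;> simp_all
  have h2 : ∀ i, B (Sum.elim X ![U, W] i) (Sum.elim X ![U, W] i) ≠ 0 := by
    rintro (i | i)
    · simp [hX]
    · fin_cases i <;> simp [hUU, hWW, hc]
  have hli := linearIndependent_of_bilin_orthonormal B h1 h2
  refine ⟨basisOfLinearIndependentOfCardEqFinrank hli (by simp [hk]), by simp, ?_, ?_⟩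
  · simpa using h1
  · simpa using h2

/-- The algebra behind minimality. `S` and `T` stand for the Hessians of two functions, as
endomorphisms, and `U`, `W` for their gradients; `h1` and `h2` say that `|U|² - |W|²` and `B(U, W)`
have vanishing derivative. Then `B(S U, U) + B(S W, W) = 0`, so the trace of `S` over the span of the
`X a` is its full trace. -/
theorem sum_bilin_eq_zero_of_trace_eq_zero [FiniteDimensional ℝ E] {k : ℕ}
    (hk : Module.finrank ℝ E = k + 2) (B : E →ₗ[ℝ] E →ₗ[ℝ] ℝ) (hB : ∀ v w, B v w = B w v)
    {U W : E} {X : Fin k → E} {c : ℝ} (hc : c ≠ 0) (hUU : B U U = c) (hWW : B W W = c)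
    (hUW : B U W = 0) (hX : ∀ a b, B (X a) (X b) = if a = b then 1 else 0)
    (hXU : ∀ a, B (X a) U = 0) (hXW : ∀ a, B (X a) W = 0)
    {S T : E →ₗ[ℝ] E} (hT : ∀ v w, B (T v) w = B (T w) v) (htr : LinearMap.trace ℝ E S = 0)
    (h1 : ∀ x, B (S x) U = B (T x) W) (h2 : ∀ x, B (S x) W + B (T x) U = 0) :
    ∑ a, B (S (X a)) (X a) = 0 := by
  obtain ⟨b, hb, ho, hne⟩ := exists_orthogonal_basis_extending hk B hB hc hUU hWW hUW hX hXU hXW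
  rw [trace_eq_sum_of_bilin_orthogonal B b ho hne, hb, Fintype.sum_sum_type] at htr
  -- `h1` at `U` and `h2` at `W`, compared by the symmetry of `T`
  have h3 : B (S U) U + B (S W) W = 0 := by
    linarith [h1 U, h2 W, hT U W]
  simpa [hX, hUU, hWW, ← add_div, h3] using htr

theorem exists_eq_of_orthogonal [FiniteDimensional ℝ E] {k : ℕ}
    (hk : Module.finrank ℝ E = k + 2) (B : E →ₗ[ℝ] E →ₗ[ℝ] ℝ) (hB : ∀ v w, B v w = B w v)
    {U W : E} {X : Fin k → E} {c : ℝ} (hc : c ≠ 0) (hUU : B U U = c) (hWW : B W W = c)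
    (hUW : B U W = 0) (hX : ∀ a b, B (X a) (X b) = if a = b then 1 else 0)
    (hXU : ∀ a, B (X a) U = 0) (hXW : ∀ a, B (X a) W = 0) {n : E} (hn : ∀ a, B n (X a) = 0) :
    ∃ r s : ℝ, n = r • U + s • W := by
  obtain ⟨b, hb, ho, hne⟩ := exists_orthogonal_basis_extending hk B hB hc hUU hWW hUW hX hXU hXW
  refine ⟨b.repr n (Sum.inr 0), b.repr n (Sum.inr 1), ?_⟩
  conv_lhs => rw [← b.sum_repr n]
  have h : ∀ a, b.repr n (Sum.inl a) = 0 := fun a => by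
    rw [repr_eq_of_bilin_orthogonal B b ho hne, hb]
    simp [hn]
  simp [Fintype.sum_sum_type, h, hb]

end LinearAlgebra

/-! ### Hessians and covariant derivatives in flat coordinates -/

section Coordinates

variable {E : Type*} [NormedAddCommGroup E] [NormedSpace ℝ E]

/-- The Hessian `∂_v ∂_w f - df(Γ(v, w))` at `y` of a function `f` of the coordinates, where `Γ`
collects the Christoffel symbols at `y`. -/
noncomputable def coordHessian (Γ : E → E → E) (f : E → ℝ) (y v w : E) : ℝ :=
  fderiv ℝ (fderiv ℝ f) y v w - fderiv ℝ f y (Γ v w)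

/-- `Γ` satisfies, at `y`, the formula that expresses the Christoffel symbols of the metric `B`
(with lowered index) through the first derivatives of `B`. -/
def IsChristoffelAt (B : E → E →L[ℝ] E →L[ℝ] ℝ) (Γ : E → E → E) (y : E) : Prop :=
  ∀ v x w, 2 * B y (Γ v x) w =
    fderiv ℝ B y v x w + fderiv ℝ B y x v w - fderiv ℝ B y w v x

variable {B : E → E →L[ℝ] E →L[ℝ] ℝ} {Γ : E → E → E} {y : E}

theorem fderiv_bilin_symm (hB : DifferentiableAt ℝ B y)
    (hsymm : ∀ᶠ z in 𝓝 y, ∀ v w, B z v w = B z w v) (x v w : E) :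
    fderiv ℝ B y x v w = fderiv ℝ B y x w v := by
  have h : ∀ v w, fderiv ℝ (fun z => B z v w) y x = fderiv ℝ B y x v w := fun v w => by
    rw [fderiv_clm_apply (hB.clm_apply (differentiableAt_const v)) (differentiableAt_const w),
      fderiv_clm_apply hB (differentiableAt_const v)]
    simp
  have h' : (fun z => B z v w) =ᶠ[𝓝 y] fun z => B z w v := hsymm.mono fun z hz => hz v w
  rw [← h, ← h, h'.fderiv_eq]

/-- The covariant derivative of the gradient `U` of `f` is the Hessian of `f`. -/
theorem IsChristoffelAt.bilin_covDeriv_gradient (hΓ : IsChristoffelAt B Γ y)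
    (hB : DifferentiableAt ℝ B y) (hsymm : ∀ᶠ z in 𝓝 y, ∀ v w, B z v w = B z w v)
    {f : E → ℝ} {U : E → E} (hU : DifferentiableAt ℝ U y)
    (hgrad : ∀ᶠ z in 𝓝 y, B z (U z) = fderiv ℝ f z) (v w : E) :
    B y (fderiv ℝ U y v + Γ v (U y)) w = coordHessian Γ f y v w := by
  have h1 : fderiv ℝ (fderiv ℝ f) y v w = B y (fderiv ℝ U y v) w + fderiv ℝ B y v (U y) w := by
    rw [← Filter.EventuallyEq.fderiv_eq hgrad, fderiv_clm_apply hB hU]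
    simp
  have h2 : fderiv ℝ f y (Γ v w) = B y (Γ v w) (U y) := by
    rw [← hgrad.self_of_nhds, hsymm.self_of_nhds]
  have h3 := hΓ v (U y) w
  have h4 := hΓ v w (U y)
  have h5 := fderiv_bilin_symm hB hsymm v w (U y)
  have h6 := fderiv_bilin_symm hB hsymm w v (U y)
  have h7 := fderiv_bilin_symm hB hsymm (U y) v w
  rw [coordHessian, h1, h2, map_add, add_apply]
  linarith

/-- The connection is compatible with the metric. -/
theorem IsChristoffelAt.fderiv_bilin_apply (hΓ : IsChristoffelAt B Γ y)
    (hB : DifferentiableAt ℝ B y) (hsymm : ∀ᶠ z in 𝓝 y, ∀ v w, B z v w = B z w v)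
    {U W : E → E} (hU : DifferentiableAt ℝ U y) (hW : DifferentiableAt ℝ W y) (x : E) :
    fderiv ℝ (fun z => B z (U z) (W z)) y x =
      B y (fderiv ℝ U y x + Γ x (U y)) (W y) + B y (fderiv ℝ W y x + Γ x (W y)) (U y) := by
  rw [fderiv_clm_apply (hB.clm_apply hU) hW, fderiv_clm_apply hB hU]
  have h3 := hΓ x (U y) (W y)
  have h4 := hΓ x (W y) (U y)
  have h5 := fderiv_bilin_symm hB hsymm x (W y) (U y)
  have h6 := fderiv_bilin_symm hB hsymm (W y) x (U y)
  have h7 := fderiv_bilin_symm hB hsymm (U y) x (W y)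
  have h8 := hsymm.self_of_nhds (U y) (fderiv ℝ W y x)
  simp only [map_add, add_apply, ContinuousLinearMap.comp_apply,
    ContinuousLinearMap.flip_apply]
  linarith

/-- Along a curve on which `df(X) = 0`, and whose velocity is `X`, the derivative of `df(X)` in the
direction `X` vanishes. -/
theorem fderiv_covDeriv_of_tangent {f : E → ℝ} {X : E → E} {c : ℝ → E}
    (hf : DifferentiableAt ℝ (fderiv ℝ f) y) (hX : DifferentiableAt ℝ X y) (hc0 : c 0 = y)
    (hc : HasDerivAt c (X y) 0) (hzero : ∀ᶠ t in 𝓝 (0 : ℝ), fderiv ℝ f (c t) (X (c t)) = 0) :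
    fderiv ℝ f y (fderiv ℝ X y (X y) + Γ (X y) (X y)) = -coordHessian Γ f y (X y) (X y) := by
  have h1 := (hf.hasFDerivAt.clm_apply hX.hasFDerivAt)
  rw [← hc0] at h1
  have h2 := h1.comp_hasDerivAt (0 : ℝ) hc
  have h3 : HasDerivAt (fun _ : ℝ => (0 : ℝ)) _ 0 :=
    h2.congr_of_eventuallyEq (hzero.mono fun t ht => ht.symm)
  have h4 := h3.unique (hasDerivAt_const (0 : ℝ) (0 : ℝ))
  rw [hc0] at h4
  simp only [add_apply, ContinuousLinearMap.comp_apply,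
    ContinuousLinearMap.flip_apply] at h4
  rw [coordHessian, map_add]
  linarith

/-- The Hessian is symmetric. The symmetry of `Γ` is only needed, and only available without
nondegeneracy of `B`, after pairing with a vector. -/
theorem IsChristoffelAt.coordHessian_comm (hΓ : IsChristoffelAt B Γ y)
    (hB : DifferentiableAt ℝ B y) (hsymm : ∀ᶠ z in 𝓝 y, ∀ v w, B z v w = B z w v)
    {f : E → ℝ} (hf : ContDiffAt ℝ 2 f y) {u : E} (hu : B y u = fderiv ℝ f y) (v w : E) :
    coordHessian Γ f y v w = coordHessian Γ f y w v := by
  have h1 := hΓ v w u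
  have h2 := hΓ w v u
  have h3 := fderiv_bilin_symm hB hsymm u v w
  have h4 := hsymm.self_of_nhds u (Γ v w)
  have h5 := hsymm.self_of_nhds u (Γ w v)
  rw [coordHessian, coordHessian, (hf.isSymmSndFDerivAt (by simp)).eq v w, ← hu]
  linarith

end Coordinates

/-! ### Charts and differentials -/

noncomputable section

variable {m : ℕ} {M : Type*} [TopologicalSpace M] [ChartedSpace (Eu m) M]

theorem mfderiv_symm_mvfderiv {e : OpenPartialHomeomorph M (Eu m)}
    (he : e.MDifferentiable (𝓡 m) (𝓡 m)) {q : M} (hq : q ∈ e.source) (v : TangentSpace (𝓡 m) q) :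
    (mfderiv (𝓡 m) (𝓡 m) e.symm (e q) (mvfderiv (𝓡 m) e q v) : Eu m) = v :=
  DFunLike.congr_fun (he.symm_comp_deriv hq) v

theorem mvfderiv_mfderiv_symm {e : OpenPartialHomeomorph M (Eu m)}
    (he : e.MDifferentiable (𝓡 m) (𝓡 m)) {y : Eu m} (hy : y ∈ e.target) (v : Eu m) :
    (mvfderiv (𝓡 m) e (e.symm y) (mfderiv (𝓡 m) (𝓡 m) e.symm y v) : Eu m) = v :=
  DFunLike.congr_fun (he.comp_symm_deriv hy) v

/-- The differential of the inverse of the chart `e`, as an endomorphism of the model space: each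
tangent space of `M` is, as a topological vector space, a copy of `ℝ^m`. -/
def symmDeriv (e : OpenPartialHomeomorph M (Eu m)) (y : Eu m) : Eu m →L[ℝ] Eu m :=
  mfderiv (𝓡 m) (𝓡 m) e.symm y

/-- The chain rule for `u = (u ∘ e.symm) ∘ e`. -/
theorem mvfderiv_eq_fderiv_comp_symm {F : Type*} [NormedAddCommGroup F] [NormedSpace ℝ F]
    {e : OpenPartialHomeomorph M (Eu m)}
    (he : e.MDifferentiable (𝓡 m) (𝓡 m)) {q : M} (hq : q ∈ e.source) {u : M → F}
    (hu : MDifferentiableAt (𝓡 m) 𝓘(ℝ, F) u q) (v : TangentSpace (𝓡 m) q) :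
    mvfderiv (𝓡 m) u q v = fderiv ℝ (u ∘ e.symm) (e q) (mvfderiv (𝓡 m) e q v) := by
  have h1 : MDifferentiableAt (𝓡 m) 𝓘(ℝ, F) u (e.symm (e q)) := by rwa [e.left_inv hq]
  have h2 := mfderiv_comp_apply (e q) h1 (he.mdifferentiableAt_symm (e.map_source hq))
    (mvfderiv (𝓡 m) e q v)
  rw [mfderiv_eq_fderiv] at h2
  -- the base point can only be rewritten after the tangent spaces are identified with `ℝ^m`
  let H : M → Eu m → F := fun x a => mvfderiv (𝓡 m) u x a
  have h3 : H q v = H (e.symm (e q)) (mfderiv (𝓡 m) (𝓡 m) e.symm (e q) (mvfderiv (𝓡 m) e q v)) := by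
    rw [e.left_inv hq]
    congr 1
    exact (mfderiv_symm_mvfderiv he hq v).symm
  exact h3.trans h2.symm

theorem mvfderiv_clm_comp {F : Type*} [NormedAddCommGroup F] [NormedSpace ℝ F] (l : F →L[ℝ] ℝ)
    {f : M → F} {p : M} (hf : MDifferentiableAt (𝓡 m) 𝓘(ℝ, F) f p) (v : TangentSpace (𝓡 m) p) :
    mvfderiv (𝓡 m) (fun x => l (f x)) p v = l (mvfderiv (𝓡 m) f p v) := by
  have h := (l.hasFDerivAt (x := f p)).hasMFDerivAt.comp p hf.hasMFDerivAt
  exact DFunLike.congr_fun h.mfderiv v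

theorem isInvertible_mvfderiv {e : OpenPartialHomeomorph M (Eu m)}
    (he : e.MDifferentiable (𝓡 m) (𝓡 m)) {q : M} (hq : q ∈ e.source) :
    (mvfderiv (𝓡 m) e q).IsInvertible :=
  ⟨he.mfderiv hq, rfl⟩

theorem fieldInChart_apply {e : OpenPartialHomeomorph M (Eu m)} (X : VField m M) {q : M}
    (hq : q ∈ e.source) : fieldInChart e X (e q) = mvfderiv (𝓡 m) e q (X q) := by
  let H : M → Eu m := fun x => mvfderiv (𝓡 m) e x (X x)
  change H (e.symm (e q)) = H q
  rw [e.left_inv hq]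

/-- The velocity condition on the curve, an equality in the tangent bundle, says that every function
`f` differentiable at `p` has derivative `df(v)` along the curve. -/
theorem IsTangentTo.exists_curve {K : Set M} {p : M} {v : TangentSpace (𝓡 m) p}
    (h : IsTangentTo K p v) : ∃ γ : ℝ → M, Continuous γ ∧ γ 0 = p ∧
      (∀ᶠ t in 𝓝 (0 : ℝ), γ t ∈ K) ∧
      ∀ (F : Type) [NormedAddCommGroup F] [NormedSpace ℝ F] (f : M → F),
        MDifferentiableAt (𝓡 m) 𝓘(ℝ, F) f p → HasDerivAt (f ∘ γ) (mvfderiv (𝓡 m) f p v) 0 := by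
  obtain ⟨γ, hγ, hK, heq⟩ := h
  have h0 : γ 0 = p := congrArg TotalSpace.proj heq
  refine ⟨γ, hγ.continuous, h0, hK, fun F _ _ f hf => ?_⟩
  let H : TangentBundle (𝓡 m) M → F := fun z => mvfderiv (𝓡 m) f z.1 z.2
  have h1 : mvfderiv (𝓡 m) f p v = mvfderiv (𝓡 m) f (γ 0) (mfderiv 𝓘(ℝ, ℝ) (𝓡 m) γ 0 (1 : ℝ)) :=
    congrArg H heq.symm
  rw [← h0] at hf
  let L : ℝ →L[ℝ] F :=
    (mfderiv (𝓡 m) 𝓘(ℝ, F) f (γ 0)).comp (mfderiv 𝓘(ℝ, ℝ) (𝓡 m) γ 0)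
  have h2 : HasMFDerivAt 𝓘(ℝ, ℝ) 𝓘(ℝ, F) (f ∘ γ) 0 L :=
    hf.hasMFDerivAt.comp (0 : ℝ) (hγ.mdifferentiableAt (by simp)).hasMFDerivAt
  have h3 : HasFDerivAt (f ∘ γ) L 0 := hasMFDerivAt_iff_hasFDerivAt.1 h2
  have h4 : HasDerivAt (f ∘ γ) (L 1) 0 := h3.hasDerivAt
  rw [h1]
  exact h4

/-- The differential of a function that vanishes on `K` kills the vectors tangent to `K`. -/
theorem IsTangentTo.mvfderiv_eq_zero {K : Set M} {p : M} {v : TangentSpace (𝓡 m) p}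
    (h : IsTangentTo K p v) {u : M → ℝ} (hu : MDifferentiableAt (𝓡 m) 𝓘(ℝ, ℝ) u p)
    (hK : ∀ q ∈ K, u q = 0) : mvfderiv (𝓡 m) u p v = 0 := by
  obtain ⟨γ, -, -, hγ, h⟩ := h.exists_curve
  refine (h ℝ u hu).unique ((hasDerivAt_const (0 : ℝ) (0 : ℝ)).congr_of_eventuallyEq ?_)
  exact hγ.mono fun t ht => hK _ ht

variable [IsManifold (𝓡 m) ∞ M]

theorem chartAt_mdifferentiable (p : M) :
    (chartAt (Eu m) p).MDifferentiable (𝓡 m) (𝓡 m) :=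
  have : IsManifold (𝓡 m) 1 M := IsManifold.of_le (n := ∞) (by simp)
  mdifferentiable_chart p

theorem contDiffAt_comp_chartAt_symm {F : Type*} [NormedAddCommGroup F] [NormedSpace ℝ F]
    {u : M → F} (hu : ContMDiff (𝓡 m) 𝓘(ℝ, F) ∞ u) {p : M} {y : Eu m}
    (hy : y ∈ (chartAt (Eu m) p).target) :
    ContDiffAt ℝ ∞ (u ∘ (chartAt (Eu m) p).symm) y :=
  contMDiffAt_iff_contDiffAt.1 <| (hu _).comp _ <|
    contMDiffAt_symm_of_mem_maximalAtlas (IsManifold.chart_mem_maximalAtlas p) hy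

/-! ### The metric in a chart -/

/-- The metric in the chart `e`, as a bilinear form on `ℝ^m` depending on the coordinates. -/
def metricInChart (g : SmoothMetric m M) (e : OpenPartialHomeomorph M (Eu m)) (y : Eu m) :
    Eu m →L[ℝ] Eu m →L[ℝ] ℝ :=
  let G : Eu m →L[ℝ] Eu m →L[ℝ] ℝ := g.inner (e.symm y)
  G.bilinearComp (symmDeriv e y) (symmDeriv e y)

theorem metricInChart_apply (g : SmoothMetric m M) (e : OpenPartialHomeomorph M (Eu m))
    (y v w : Eu m) : metricInChart g e y v w =
      g.inner (e.symm y) (mfderiv (𝓡 m) (𝓡 m) e.symm y v) (mfderiv (𝓡 m) (𝓡 m) e.symm y w) :=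
  rfl

theorem gramMatrix_apply (g : SmoothMetric m M) (e : OpenPartialHomeomorph M (Eu m))
    (y : Eu m) (i j : Fin m) : gramMatrix g e y i j =
      metricInChart g e y (EuclideanSpace.single i 1) (EuclideanSpace.single j 1) :=
  rfl

theorem metricInChart_symm (g : SmoothMetric m M) (e : OpenPartialHomeomorph M (Eu m))
    (y v w : Eu m) : metricInChart g e y v w = metricInChart g e y w v :=
  g.symm _ _ _

theorem inner_eq_metricInChart (g : SmoothMetric m M) {e : OpenPartialHomeomorph M (Eu m)}
    (he : e.MDifferentiable (𝓡 m) (𝓡 m)) {q : M} (hq : q ∈ e.source)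
    (v w : TangentSpace (𝓡 m) q) :
    g.inner q v w = metricInChart g e (e q) (mvfderiv (𝓡 m) e q v) (mvfderiv (𝓡 m) e q w) := by
  rw [metricInChart_apply]
  let H : M → Eu m → Eu m → ℝ := fun x a b => g.inner x a b
  change H q v w = H (e.symm (e q)) _ _
  rw [e.left_inv hq]
  congr 1
  · exact (mfderiv_symm_mvfderiv he hq v).symm
  · exact (mfderiv_symm_mvfderiv he hq w).symm

theorem inner_grad (g : SmoothMetric m M) (u : M → ℝ) (q : M) (v : TangentSpace (𝓡 m) q) :
    g.inner q (grad g u q) v = mvfderiv (𝓡 m) u q v :=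
  (exists_gradient g u q).choose_spec v

/-- In a chart, the gradient of `u` is the vector dual to `du`. -/
theorem metricInChart_grad (g : SmoothMetric m M) {e : OpenPartialHomeomorph M (Eu m)}
    (he : e.MDifferentiable (𝓡 m) (𝓡 m)) {y : Eu m} (hy : y ∈ e.target) {u : M → ℝ}
    (hu : MDifferentiable (𝓡 m) 𝓘(ℝ, ℝ) u) :
    metricInChart g e y (fieldInChart e (grad g u) y) = fderiv ℝ (u ∘ e.symm) y := by
  ext w
  have h := inner_eq_metricInChart g he (e.map_target hy) (grad g u (e.symm y))
    (mfderiv (𝓡 m) (𝓡 m) e.symm y w)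
  rw [inner_grad, mvfderiv_eq_fderiv_comp_symm he (e.map_target hy) (hu _), e.right_inv hy,
     mvfderiv_mfderiv_symm he hy] at h
  exact h.symm

theorem metricInChart_pos (g : SmoothMetric m M) {e : OpenPartialHomeomorph M (Eu m)}
    (he : e.MDifferentiable (𝓡 m) (𝓡 m)) {y : Eu m} (hy : y ∈ e.target) {v : Eu m}
    (hv : v ≠ 0) : 0 < metricInChart g e y v v := by
  refine g.pos (e.symm y) (mfderiv (𝓡 m) (𝓡 m) e.symm y v) fun h => hv ?_
  rw [← mvfderiv_mfderiv_symm he hy v, h, map_zero]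

theorem metricInChart_isInvertible (g : SmoothMetric m M) {e : OpenPartialHomeomorph M (Eu m)}
    (he : e.MDifferentiable (𝓡 m) (𝓡 m)) {y : Eu m} (hy : y ∈ e.target) :
    (metricInChart g e y).IsInvertible := by
  have hinj : Function.Injective (metricInChart g e y).toLinearMap := by
    refine (injective_iff_map_eq_zero _).2 fun v hv => ?_
    by_contra h
    have := metricInChart_pos g he hy h
    rw [show metricInChart g e y v = 0 from hv] at this
    simp at this
  have hfin : Module.finrank ℝ (Eu m) = Module.finrank ℝ (Eu m →L[ℝ] ℝ) := by
    rw [← (LinearMap.toContinuousLinearMap (𝕜 := ℝ) (E := Eu m) (F' := ℝ)).finrank_eq]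
    exact (Subspace.dual_finrank_eq (K := ℝ) (V := Eu m)).symm
  exact ⟨(LinearEquiv.ofInjectiveOfFinrankEq _ hinj hfin).toContinuousLinearEquiv, by ext; rfl⟩

/-- The components of a smooth field are smooth: they are its coordinates in the trivialization of
the tangent bundle at `p`, which is the differential of the chart. -/
theorem contDiffAt_fieldInChart {p : M} {X : VField m M}
    (hX : ContMDiffAt (𝓡 m) (𝓡 m).tangent ∞ (fun x => (⟨x, X x⟩ : TangentBundle (𝓡 m) M)) p) :
    ContDiffAt ℝ ∞ (fieldInChart (chartAt (Eu m) p) X) (chartAt (Eu m) p p) := by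
  have : IsManifold (𝓡 m) 1 M := IsManifold.of_le (n := ∞) (by simp)
  set e := chartAt (Eu m) p
  have hp : p ∈ e.source := mem_chart_source _ p
  rw [Bundle.contMDiffAt_section] at hX
  have h1 : ContMDiffAt (𝓡 m) (𝓡 m) ∞ e.symm (e p) :=
    contMDiffAt_symm_of_mem_maximalAtlas (IsManifold.chart_mem_maximalAtlas p) (e.map_source hp)
  have h2 := ContMDiffAt.comp_of_eq hX h1 (e.left_inv hp)
  rw [contMDiffAt_iff_contDiffAt] at h2
  refine h2.congr_of_eventuallyEq ?_
  filter_upwards [e.open_target.mem_nhds (e.map_source hp)] with y hy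
  have h3 := DFunLike.congr_fun (TangentBundle.continuousLinearMapAt_trivializationAt (𝕜 := ℝ)
    (I := 𝓡 m) (e.map_target hy)) (X (e.symm y))
  rw [Trivialization.continuousLinearMapAt_apply, Trivialization.linearMapAt_apply] at h3
  exact h3.symm.trans (if_pos (e.map_target hy))

/-- The field with constant components `v` in a chart, as a section of the tangent bundle along the
inverse of the chart, is smooth. -/
theorem contMDiffAt_coordinateField {p : M} {y : Eu m} (hy : y ∈ (chartAt (Eu m) p).target)
    (v : Eu m) :
    ContMDiffAt (𝓡 m) (𝓡 m).tangent ∞ (fun z => (⟨(chartAt (Eu m) p).symm z,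
      mfderiv (𝓡 m) (𝓡 m) (chartAt (Eu m) p).symm z v⟩ : TangentBundle (𝓡 m) M)) y := by
  have : IsManifold (𝓡 m) 1 M := IsManifold.of_le (n := ∞) (by simp)
  have he := chartAt_mdifferentiable (m := m) p
  set e := chartAt (Eu m) p
  have hp : p ∈ e.source := mem_chart_source _ p
  rw [Trivialization.contMDiffAt_iff (n := ∞) (IB := 𝓡 m)
    (e := trivializationAt (Eu m) (TangentSpace (𝓡 m)) p)]
  · refine ⟨contMDiffAt_symm_of_mem_maximalAtlas (IsManifold.chart_mem_maximalAtlas p) hy, ?_⟩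
    refine (contMDiffAt_const (c := v)).congr_of_eventuallyEq ?_
    filter_upwards [e.open_target.mem_nhds hy] with z hz
    have h3 := DFunLike.congr_fun (TangentBundle.continuousLinearMapAt_trivializationAt (𝕜 := ℝ)
      (I := 𝓡 m) (e.map_target hz)) (mfderiv (𝓡 m) (𝓡 m) e.symm z v)
    rw [Trivialization.continuousLinearMapAt_apply, Trivialization.linearMapAt_apply] at h3
    exact ((if_pos (e.map_target hz)).symm.trans h3).trans (mvfderiv_mfderiv_symm he hz v)
  · exact (Trivialization.mem_source _).2 (e.map_target hy)

theorem contDiffOn_metricInChart (g : SmoothMetric m M) (p : M) :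
    ContDiffOn ℝ ∞ (metricInChart g (chartAt (Eu m) p)) (chartAt (Eu m) p).target := by
  simp_rw [contDiffOn_clm_apply]
  intro v w y hy
  have h1 := contMDiffAt_coordinateField hy v
  have h2 := contMDiffAt_coordinateField hy w
  have h3 := (g.contMDiff ((chartAt (Eu m) p).symm y)).comp y
    (contMDiffAt_symm_of_mem_maximalAtlas (n := ∞) (IsManifold.chart_mem_maximalAtlas p) hy)
  have h4 := ContMDiffAt.clm_bundle_apply₂ (F₁ := Eu m) (F₂ := Eu m) (F₃ := ℝ)
    (E₁ := fun x : M => TangentSpace (𝓡 m) x) (E₂ := fun x : M => TangentSpace (𝓡 m) x)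
    (E₃ := Bundle.Trivial M ℝ) h3 h1 h2
  rw [contMDiffAt_totalSpace] at h4
  exact h4.2.contDiffAt.contDiffWithinAt

theorem contDiffAt_grad (g : SmoothMetric m M) {u : M → ℝ}
    (hu : ContMDiff (𝓡 m) 𝓘(ℝ, ℝ) ∞ u) (p : M) :
    ContDiffAt ℝ ∞ (fieldInChart (chartAt (Eu m) p) (grad g u)) (chartAt (Eu m) p p) := by
  have he := chartAt_mdifferentiable (m := m) p
  have hy := (chartAt (Eu m) p).map_source (mem_chart_source _ p)
  have ht := (chartAt (Eu m) p).open_target.mem_nhds hy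
  have hB := (contDiffOn_metricInChart g p).contDiffAt ht
  have hinv := metricInChart_isInvertible g he hy
  have h2 := (contDiffAt_comp_chartAt_symm hu hy).fderiv_right (m := ∞) (by simp)
  -- `∇u` has components `B⁻¹ du`, where `B` is the metric in the chart
  refine ((hinv.contDiffAt_map_inverse.comp _ hB).clm_apply h2).congr_of_eventuallyEq ?_
  filter_upwards [ht] with y hy
  rw [← metricInChart_grad g he hy (hu.mdifferentiable (by simp))]
  exact ((metricInChart_isInvertible g he hy).inverse_apply_eq.2 rfl).symm

/-! ### Christoffel symbols -/

theorem EuclideanSpace.clm_apply_eq_sum {m : ℕ} {F : Type*} [AddCommGroup F] [Module ℝ F]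
    [TopologicalSpace F] (ψ : Eu m →L[ℝ] F) (w : Eu m) :
    ψ w = ∑ l, w l • ψ (EuclideanSpace.single l 1) := by
  have h := (EuclideanSpace.basisFun (Fin m) ℝ).sum_repr w
  conv_lhs => rw [← h]
  simp [map_sum]

/-- The vector `Γ(v, x)` with components `∑_{i,j} Γ^k_{ij} v^i x^j`, at the coordinates `y`. -/
def christoffelForm (g : SmoothMetric m M) (e : OpenPartialHomeomorph M (Eu m)) (y v x : Eu m) :
    Eu m :=
  Matrix.toEuclideanLin (Matrix.of fun k i : Fin m => ∑ j, christoffel g e y k i j * x j) v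

theorem covDerivInChart_apply (g : SmoothMetric m M) (e : OpenPartialHomeomorph M (Eu m))
    (X : Eu m → Eu m) (y v : Eu m) :
    covDerivInChart g e X y v = fderiv ℝ X y v + christoffelForm g e y v (X y) :=
  rfl

theorem isUnit_det_gramMatrix (g : SmoothMetric m M) {e : OpenPartialHomeomorph M (Eu m)}
    (he : e.MDifferentiable (𝓡 m) (𝓡 m)) {y : Eu m} (hy : y ∈ e.target) :
    IsUnit (gramMatrix g e y).det := by
  rw [← Matrix.isUnit_iff_isUnit_det, ← Matrix.vecMul_injective_iff_isUnit]
  refine (injective_iff_map_eq_zero (Matrix.vecMulLinear (gramMatrix g e y))).2 fun a ha => ?_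
  by_contra hne
  have hpos := metricInChart_pos g he hy (v := WithLp.toLp 2 a) (by simpa using hne)
  refine hpos.ne' ?_
  rw [EuclideanSpace.clm_apply_eq_sum (metricInChart g e y (WithLp.toLp 2 a))]
  refine Finset.sum_eq_zero fun l _ => ?_
  have h : metricInChart g e y (WithLp.toLp 2 a) (EuclideanSpace.single l 1) =
      (Matrix.vecMulLinear (gramMatrix g e y)) a l := by
    rw [EuclideanSpace.clm_apply_eq_sum (metricInChart g e y), sum_apply]
    rfl
  rw [h, ha]
  simp

theorem gramDeriv_eq (g : SmoothMetric m M) {e : OpenPartialHomeomorph M (Eu m)} {y : Eu m}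
    (hB : DifferentiableAt ℝ (metricInChart g e) y) (i j l : Fin m) :
    gramDeriv g e y i j l = fderiv ℝ (metricInChart g e) y (EuclideanSpace.single i 1)
      (EuclideanSpace.single j 1) (EuclideanSpace.single l 1) := by
  have h : gramDeriv g e y i j l = fderiv ℝ (fun z => metricInChart g e z
      (EuclideanSpace.single j 1) (EuclideanSpace.single l 1)) y (EuclideanSpace.single i 1) := rfl
  rw [h, fderiv_clm_apply (hB.clm_apply (differentiableAt_const _)) (differentiableAt_const _),
      fderiv_clm_apply hB (differentiableAt_const _)]
  simp

/-- The Christoffel symbols, with lowered index, are given by the derivatives of the metric. -/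
theorem isChristoffelAt_christoffelForm (g : SmoothMetric m M)
    {e : OpenPartialHomeomorph M (Eu m)} (he : e.MDifferentiable (𝓡 m) (𝓡 m)) {y : Eu m}
    (hy : y ∈ e.target) (hB : DifferentiableAt ℝ (metricInChart g e) y) :
    IsChristoffelAt (metricInChart g e) (christoffelForm g e y) y := by
  intro v x w
  set T := fderiv ℝ (metricInChart g e) y
  -- `S` is twice the vector `Γ(v, x)` with its index lowered by the metric
  let S : Eu m →L[ℝ] ℝ := T v x + T x v -
    (ContinuousLinearMap.apply ℝ ℝ x).comp ((ContinuousLinearMap.apply ℝ (Eu m →L[ℝ] ℝ) v).comp T)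
  have hexp : ∀ (v x : Eu m) (R : Eu m →L[ℝ] Eu m →L[ℝ] ℝ), R v x = ∑ i, ∑ j,
      v i * x j * R (EuclideanSpace.single i 1) (EuclideanSpace.single j 1) := by
    intro v x R
    rw [EuclideanSpace.clm_apply_eq_sum R, sum_apply]
    refine Finset.sum_congr rfl fun i _ => ?_
    rw [smul_apply, EuclideanSpace.clm_apply_eq_sum (R _), Finset.smul_sum]
    exact Finset.sum_congr rfl fun j _ => by simp [mul_assoc]
  -- the components of `S` in terms of the derivatives of the Gram matrix
  have hS : ∀ l, S (EuclideanSpace.single l 1) = ∑ i, ∑ j, v i * x j *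
      (gramDeriv g e y i j l + gramDeriv g e y j i l - gramDeriv g e y l i j) := by
    intro l
    let Tl : Eu m →L[ℝ] Eu m →L[ℝ] ℝ :=
      (ContinuousLinearMap.apply ℝ ℝ (EuclideanSpace.single l 1 : Eu m)).postcomp _ ∘L T
    have h1 := hexp v x Tl
    have h2 := hexp v x Tl.flip
    have h3 := hexp v x (T (EuclideanSpace.single l 1))
    simp only [gramDeriv_eq g hB, mul_sub, mul_add, Finset.sum_sub_distrib, Finset.sum_add_distrib]
    exact congrArg₂ _ (congrArg₂ _ h1 h2) (congrArg Neg.neg h3)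
  have hΓ : ∀ k, christoffelForm g e y v x k =
      (1 / 2) * ∑ l, (gramMatrix g e y)⁻¹ k l * S (EuclideanSpace.single l 1) := by
    intro k
    have h1 : christoffelForm g e y v x k =
        ∑ i, (∑ j, christoffel g e y k i j * x j) * v i := rfl
    simp only [h1, hS, christoffel, Finset.mul_sum, Finset.sum_mul]
    rw [Finset.sum_comm_cycle]
    exact Finset.sum_congr rfl fun l _ => Finset.sum_congr rfl fun i _ =>
      Finset.sum_congr rfl fun j _ => by ring
  -- multiplying by the Gram matrix cancels its inverse in the definition of `Γ`
  have hlow : ∀ l, 2 * metricInChart g e y (christoffelForm g e y v x) (EuclideanSpace.single l 1) =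
      S (EuclideanSpace.single l 1) := by
    intro l
    rw [metricInChart_symm, EuclideanSpace.clm_apply_eq_sum (metricInChart g e y _)]
    simp only [hΓ, ← gramMatrix_apply]
    have h := congrFun ((gramMatrix g e y).mulVec_mulVec (fun l => S (EuclideanSpace.single l 1))
      (gramMatrix g e y)⁻¹) l
    rw [Matrix.mul_nonsing_inv _ (isUnit_det_gramMatrix g he hy), Matrix.one_mulVec] at h
    rw [← h]
    simp only [Matrix.mulVec, dotProduct, smul_eq_mul, Finset.mul_sum, Finset.sum_mul]
    exact Finset.sum_congr rfl fun k _ => Finset.sum_congr rfl fun l _ => by ring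
  have hw : S w = T v x w + T x v w - T w v x := rfl
  rw [← hw, EuclideanSpace.clm_apply_eq_sum S,
    EuclideanSpace.clm_apply_eq_sum (metricInChart g e y _), Finset.mul_sum]
  refine Finset.sum_congr rfl fun l _ => ?_
  rw [← hlow, smul_eq_mul, smul_eq_mul]
  ring

/-! ### The connection and the gradient in the chart at a point -/

theorem mvfderiv_leviCivita (g : SmoothMetric m M) (X : VField m M) (p : M)
    (v : TangentSpace (𝓡 m) p) :
    mvfderiv (𝓡 m) (chartAt (Eu m) p) p (leviCivita g X p v) =
      covDerivInChart g (chartAt (Eu m) p) (fieldInChart (chartAt (Eu m) p) X)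
        (chartAt (Eu m) p p) (mvfderiv (𝓡 m) (chartAt (Eu m) p) p v) :=
  (isInvertible_mvfderiv (chartAt_mdifferentiable (m := m) p)
    (mem_chart_source _ p)).inverse_apply_eq.1 rfl |>.symm

theorem divergence_eq_trace (g : SmoothMetric m M) (X : VField m M) (p : M) :
    divergence g X p = LinearMap.trace ℝ (Eu m) (covDerivInChart g (chartAt (Eu m) p)
      (fieldInChart (chartAt (Eu m) p) X) (chartAt (Eu m) p p)) := by
  obtain ⟨D, hD⟩ := isInvertible_mvfderiv (chartAt_mdifferentiable (m := m) p)
    (mem_chart_source _ p)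
  have h : leviCivita g X p = D.symm.toLinearEquiv.conj (covDerivInChart g (chartAt (Eu m) p)
      (fieldInChart (chartAt (Eu m) p) X) (chartAt (Eu m) p p)) := by
    ext v
    simp only [leviCivita, ← hD, ContinuousLinearMap.inverse_equiv]
    rfl
  rw [divergence, h, LinearMap.trace_conj']

theorem gradInner_eq (g : SmoothMetric m M) {e : OpenPartialHomeomorph M (Eu m)}
    (he : e.MDifferentiable (𝓡 m) (𝓡 m)) {q : M} (hq : q ∈ e.source) (u w : M → ℝ) :
    gradInner g u w q = metricInChart g e (e q) (fieldInChart e (grad g u) (e q))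
      (fieldInChart e (grad g w) (e q)) := by
  rw [gradInner, inner_eq_metricInChart g he hq, fieldInChart_apply _ hq, fieldInChart_apply _ hq]

theorem differentiableAt_metricInChart (g : SmoothMetric m M) (p : M) :
    DifferentiableAt ℝ (metricInChart g (chartAt (Eu m) p)) (chartAt (Eu m) p p) :=
  ((contDiffOn_metricInChart g p).contDiffAt ((chartAt (Eu m) p).open_target.mem_nhds
    ((chartAt (Eu m) p).map_source (mem_chart_source _ p)))).differentiableAt (by simp)

theorem isChristoffelAt_chartAt (g : SmoothMetric m M) (p : M) :
    IsChristoffelAt (metricInChart g (chartAt (Eu m) p))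
    (christoffelForm g (chartAt (Eu m) p) (chartAt (Eu m) p p)) (chartAt (Eu m) p p) :=
  isChristoffelAt_christoffelForm g (chartAt_mdifferentiable (m := m) p)
    ((chartAt (Eu m) p).map_source (mem_chart_source _ p)) (differentiableAt_metricInChart g p)

theorem eventually_metricInChart_symm (g : SmoothMetric m M) (p : M) :
    ∀ᶠ y in 𝓝 (chartAt (Eu m) p p), ∀ v w,
    metricInChart g (chartAt (Eu m) p) y v w = metricInChart g (chartAt (Eu m) p) y w v :=
  Eventually.of_forall fun y => metricInChart_symm g _ y

theorem eventually_metricInChart_grad (g : SmoothMetric m M) (p : M)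
    {u : M → ℝ} (hu : ContMDiff (𝓡 m) 𝓘(ℝ, ℝ) ∞ u) : ∀ᶠ y in 𝓝 (chartAt (Eu m) p p),
    metricInChart g (chartAt (Eu m) p) y (fieldInChart (chartAt (Eu m) p) (grad g u) y) =
      fderiv ℝ (u ∘ (chartAt (Eu m) p).symm) y := by
  have h := (chartAt (Eu m) p).open_target.mem_nhds
    ((chartAt (Eu m) p).map_source (mem_chart_source _ p))
  filter_upwards [h] with y hy
  exact metricInChart_grad g (chartAt_mdifferentiable (m := m) p) hy (hu.mdifferentiable (by simp))

/-- `g(∇_v ∇u, x) = Hess u (v, x)` in the chart at `p`. -/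
theorem metricInChart_covDeriv_grad (g : SmoothMetric m M) (p : M)
    {u : M → ℝ} (hu : ContMDiff (𝓡 m) 𝓘(ℝ, ℝ) ∞ u) (v x : Eu m) :
    metricInChart g (chartAt (Eu m) p) (chartAt (Eu m) p p)
      (covDerivInChart g (chartAt (Eu m) p) (fieldInChart (chartAt (Eu m) p) (grad g u))
        (chartAt (Eu m) p p) v) x =
    coordHessian (christoffelForm g (chartAt (Eu m) p) (chartAt (Eu m) p p))
      (u ∘ (chartAt (Eu m) p).symm) (chartAt (Eu m) p p) v x :=
  (isChristoffelAt_chartAt g p).bilin_covDeriv_gradient (differentiableAt_metricInChart g p)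
    (eventually_metricInChart_symm g p) ((contDiffAt_grad g hu p).differentiableAt (by simp))
    (eventually_metricInChart_grad g p hu) v x

/-- The Hessian of a function, as an endomorphism, is self-adjoint. -/
theorem metricInChart_covDeriv_grad_comm (g : SmoothMetric m M) (p : M)
    {u : M → ℝ} (hu : ContMDiff (𝓡 m) 𝓘(ℝ, ℝ) ∞ u) (v x : Eu m) :
    metricInChart g (chartAt (Eu m) p) (chartAt (Eu m) p p)
      (covDerivInChart g (chartAt (Eu m) p) (fieldInChart (chartAt (Eu m) p) (grad g u))
        (chartAt (Eu m) p p) v) x =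
    metricInChart g (chartAt (Eu m) p) (chartAt (Eu m) p p)
      (covDerivInChart g (chartAt (Eu m) p) (fieldInChart (chartAt (Eu m) p) (grad g u))
        (chartAt (Eu m) p p) x) v := by
  have h := contDiffAt_comp_chartAt_symm hu
    ((chartAt (Eu m) p).map_source (mem_chart_source _ p))
  rw [metricInChart_covDeriv_grad g p hu, metricInChart_covDeriv_grad g p hu]
  exact (isChristoffelAt_chartAt g p).coordHessian_comm (differentiableAt_metricInChart g p)
    (eventually_metricInChart_symm g p) (h.of_le (by norm_cast))
    (eventually_metricInChart_grad g p hu).self_of_nhds v x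

/-- `d(g(∇u, ∇w))(x) = g(∇_x ∇u, ∇w) + g(∇_x ∇w, ∇u)` in the chart at `p`. -/
theorem hasFDerivAt_gradInner_comp_symm (g : SmoothMetric m M) (p : M) {u w : M → ℝ}
    (hu : ContMDiff (𝓡 m) 𝓘(ℝ, ℝ) ∞ u) (hw : ContMDiff (𝓡 m) 𝓘(ℝ, ℝ) ∞ w) :
    ∃ L : Eu m →L[ℝ] ℝ, HasFDerivAt (fun y => gradInner g u w ((chartAt (Eu m) p).symm y)) L
      (chartAt (Eu m) p p) ∧ ∀ x, L x =
      metricInChart g (chartAt (Eu m) p) (chartAt (Eu m) p p)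
        (covDerivInChart g (chartAt (Eu m) p) (fieldInChart (chartAt (Eu m) p) (grad g u))
          (chartAt (Eu m) p p) x)
        (fieldInChart (chartAt (Eu m) p) (grad g w) (chartAt (Eu m) p p)) +
      metricInChart g (chartAt (Eu m) p) (chartAt (Eu m) p p)
        (covDerivInChart g (chartAt (Eu m) p) (fieldInChart (chartAt (Eu m) p) (grad g w))
          (chartAt (Eu m) p p) x)
        (fieldInChart (chartAt (Eu m) p) (grad g u) (chartAt (Eu m) p p)) := by
  have hB := differentiableAt_metricInChart g p
  have hU := (contDiffAt_grad g hu p).differentiableAt (by simp)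
  have hW := (contDiffAt_grad g hw p).differentiableAt (by simp)
  refine ⟨_, ((hB.clm_apply hU).clm_apply hW).hasFDerivAt.congr_of_eventuallyEq ?_, fun x =>
    (isChristoffelAt_chartAt g p).fderiv_bilin_apply hB (eventually_metricInChart_symm g p) hU hW x⟩
  have h := (chartAt (Eu m) p).open_target.mem_nhds
    ((chartAt (Eu m) p).map_source (mem_chart_source _ p))
  filter_upwards [h] with y hy
  rw [gradInner_eq g (chartAt_mdifferentiable (m := m) p) ((chartAt (Eu m) p).map_target hy),
    (chartAt (Eu m) p).right_inv hy]

/-- For a field `X` tangent to a level set of `u`, `du(∇_X X) = -Hess u (X, X)`. -/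
theorem IsTangentFieldNear.inner_grad_leviCivita (g : SmoothMetric m M) {K : Set M} {p : M}
    {X : VField m M} (hX : IsTangentFieldNear K p X) (hp : p ∈ K) {u : M → ℝ}
    (hu : ContMDiff (𝓡 m) 𝓘(ℝ, ℝ) ∞ u) (hK : ∀ q ∈ K, u q = 0) :
    g.inner p (leviCivita g X p (X p)) (grad g u p) =
      -coordHessian (christoffelForm g (chartAt (Eu m) p) (chartAt (Eu m) p p))
        (u ∘ (chartAt (Eu m) p).symm) (chartAt (Eu m) p p)
        (mvfderiv (𝓡 m) (chartAt (Eu m) p) p (X p)) (mvfderiv (𝓡 m) (chartAt (Eu m) p) p (X p)) := by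
  obtain ⟨O, hO, hpO, hXO, htan⟩ := hX
  have he := chartAt_mdifferentiable (m := m) p
  have hps := mem_chart_source (Eu m) p
  have hXd := (contDiffAt_fieldInChart ((hXO p hpO).contMDiffAt (hO.mem_nhds hpO))).differentiableAt
    (by simp)
  obtain ⟨γ, hγc, hγ0, hγK, hγ⟩ := (htan p ⟨hpO, hp⟩).exists_curve
  have hud := (contDiffAt_comp_chartAt_symm hu ((chartAt (Eu m) p).map_source hps)).fderiv_right
    (m := 1) (by norm_cast)
  have hγe := hγ _ (chartAt (Eu m) p) (he.mdifferentiableAt hps)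
  rw [g.symm, inner_grad, mvfderiv_eq_fderiv_comp_symm he hps (hu.mdifferentiable (by simp) p),
    mvfderiv_leviCivita, covDerivInChart_apply]
  rw [← fieldInChart_apply X hps] at hγe ⊢
  refine fderiv_covDeriv_of_tangent (hud.differentiableAt (by simp)) hXd
    (by rw [Function.comp_apply, hγ0]) hγe ?_
  have h1 : ∀ᶠ t in 𝓝 (0 : ℝ), γ t ∈ O ∩ (chartAt (Eu m) p).source :=
    hγc.continuousAt.eventually_mem ((hO.inter (chartAt (Eu m) p).open_source).mem_nhds
      (by rw [hγ0]; exact ⟨hpO, hps⟩))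
  filter_upwards [h1, hγK] with t ht1 ht2
  rw [Function.comp_apply, fieldInChart_apply X ht1.2,
    ← mvfderiv_eq_fderiv_comp_symm he ht1.2 (hu.mdifferentiable (by simp) _)]
  exact (htan _ ⟨ht1.1, ht2⟩).mvfderiv_eq_zero (hu.mdifferentiable (by simp) _) hK

/-! ### Minimality -/

/-- The mean curvature at `p` of a set `K` of codimension two on which `u` and `w` vanish is zero if
`Δu = Δw = 0` at `p` and the conformality relations `|∇u|² = |∇w|²`, `g(∇u, ∇w) = 0` hold to first
order at `p`. -/
theorem meanCurvatureVanishesAt_of_horizontally_conformal (g : SmoothMetric m M) {k : ℕ}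
    (hk : m = k + 2) {K : Set M} {p : M} (hp : p ∈ K) {u w : M → ℝ}
    (hu : ContMDiff (𝓡 m) 𝓘(ℝ, ℝ) ∞ u) (hw : ContMDiff (𝓡 m) 𝓘(ℝ, ℝ) ∞ w)
    (hKu : ∀ q ∈ K, u q = 0) (hKw : ∀ q ∈ K, w q = 0)
    (hdu : divergence g (grad g u) p = 0) (hdw : divergence g (grad g w) p = 0)
    (hne : gradInner g u u p ≠ 0) (heq : gradInner g u u p = gradInner g w w p)
    (horth : gradInner g u w p = 0)
    (hdeq : HasFDerivAt (fun y => gradInner g u u ((chartAt (Eu m) p).symm y) -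
      gradInner g w w ((chartAt (Eu m) p).symm y)) (0 : Eu m →L[ℝ] ℝ) (chartAt (Eu m) p p))
    (hdorth : HasFDerivAt (fun y => gradInner g u w ((chartAt (Eu m) p).symm y))
      (0 : Eu m →L[ℝ] ℝ) (chartAt (Eu m) p p)) :
    MeanCurvatureVanishesAt g k K p := by
  intro V hV hVo n hn
  have he := chartAt_mdifferentiable (m := m) p
  have hps := mem_chart_source (Eu m) p
  have hVu := fun a => (hV a).inner_grad_leviCivita g hp hu hKu
  have hVw := fun a => (hV a).inner_grad_leviCivita g hp hw hKw
  have hVt : ∀ a, IsTangentTo K p (V a p) := fun a => by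
    obtain ⟨O, -, hpO, -, h⟩ := hV a
    exact h p ⟨hpO, hp⟩
  have hVU : ∀ a, g.inner p (V a p) (grad g u p) = 0 := fun a => by
    rw [g.symm, inner_grad]
    exact (hVt a).mvfderiv_eq_zero (hu.mdifferentiable (by simp) _) hKu
  have hVW : ∀ a, g.inner p (V a p) (grad g w p) = 0 := fun a => by
    rw [g.symm, inner_grad]
    exact (hVt a).mvfderiv_eq_zero (hw.mdifferentiable (by simp) _) hKw
  have hnV : ∀ a, g.inner p n (V a p) = 0 := fun a => hn _ (hVt a)
  have hnn : g.inner p (∑ a, leviCivita g (V a) p (V a p)) n =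
    ∑ a, g.inner p (leviCivita g (V a) p (V a p)) n := by
    rw [map_sum, sum_apply]
  rw [hnn]
  rw [gradInner_eq g he hps] at hne heq horth
  rw [gradInner_eq g he hps] at heq
  rw [divergence_eq_trace] at hdu hdw
  simp only [inner_eq_metricInChart g he hps, ← fieldInChart_apply _ hps] at hVo hVU hVW hVu hVw hnV ⊢
  obtain ⟨L1, hL1, h1⟩ := hasFDerivAt_gradInner_comp_symm g p hu hu
  obtain ⟨L2, hL2, h2⟩ := hasFDerivAt_gradInner_comp_symm g p hw hw
  obtain ⟨L3, hL3, h3⟩ := hasFDerivAt_gradInner_comp_symm g p hu hw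
  have hL12 := (hL1.sub hL2).unique hdeq
  have hL30 := hL3.unique hdorth
  have hsu := metricInChart_covDeriv_grad_comm g p hu
  have hsw := metricInChart_covDeriv_grad_comm g p hw
  simp only [← metricInChart_covDeriv_grad g p hu] at hVu
  simp only [← metricInChart_covDeriv_grad g p hw] at hVw
  have hB := metricInChart_symm g (chartAt (Eu m) p) (chartAt (Eu m) p p)
  have hx1 : ∀ x, L1 x = L2 x := fun x => sub_eq_zero.1 (DFunLike.congr_fun hL12 x)
  have hx2 : ∀ x, L3 x = 0 := fun x => DFunLike.congr_fun hL30 x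
  simp only [h1, h2, ← two_mul, mul_right_inj' (two_ne_zero (α := ℝ))] at hx1
  simp only [h3] at hx2
  have hfr : Module.finrank ℝ (Eu m) = k + 2 := by rw [finrank_euclideanSpace_fin, hk]
  let B := (ContinuousLinearMap.coeLM ℝ).comp
    (metricInChart g (chartAt (Eu m) p) (chartAt (Eu m) p p)).toLinearMap
  -- the hypotheses are symmetric under the exchange of `u` and `w`
  have hS := sum_bilin_eq_zero_of_trace_eq_zero hfr B hB hne rfl heq.symm horth hVo hVU hVW
    hsw hdu hx1 hx2
  have hT := sum_bilin_eq_zero_of_trace_eq_zero hfr B hB hne heq.symm rfl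
    ((hB _ _).trans horth) hVo hVW hVU
    hsu hdw (fun x => (hx1 x).symm) (fun x => (add_comm _ _).trans (hx2 x))
  -- a normal vector is a combination of the two gradients
  obtain ⟨r, s, hrs⟩ := exists_eq_of_orthogonal hfr B hB hne rfl heq.symm horth hVo hVU hVW hnV
  rw [hrs]
  simp only [map_add, map_smul, hVu, hVw, smul_eq_mul, Finset.sum_add_distrib, ← Finset.mul_sum,
    Finset.sum_neg_distrib]
  have hBa : ∀ v x, B v x = metricInChart g (chartAt (Eu m) p) (chartAt (Eu m) p p) v x :=
    fun _ _ => rfl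
  simp only [hBa] at hS hT
  linear_combination (-r) * hS - s * hT

theorem gradInner_comm (g : SmoothMetric m M) (u w : M → ℝ) (p : M) :
    gradInner g u w p = gradInner g w u p := g.symm _ _ _

theorem meanCurvatureVanishesAt_of_eigenfunction (g : SmoothMetric m M) {φ : M → ℂ}
    (hφ : IsEigenfunction g φ) (h_reg : IsRegularValue (m := m) φ 0) {k : ℕ} (hk : m = k + 2)
    {p : M} (hp : φ p = 0) : MeanCurvatureVanishesAt g k (φ ⁻¹' {0}) p := by
  obtain ⟨hs, lam, mu, hlm⟩ := hφ
  have hre : ContMDiff (𝓡 m) 𝓘(ℝ, ℝ) ∞ fun x => (φ x).re :=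
    Complex.reCLM.contDiff.contMDiff.comp hs
  have him : ContMDiff (𝓡 m) 𝓘(ℝ, ℝ) ∞ fun x => (φ x).im :=
    Complex.imCLM.contDiff.contMDiff.comp hs
  have hps := mem_chart_source (Eu m) p
  have hdiv : divergence g (grad g fun x => (φ x).re) p = 0 ∧
      divergence g (grad g fun x => (φ x).im) p = 0 := by
    have h := (hlm p).1
    rw [hp, mul_zero, tension, Complex.ext_iff] at h
    simpa using h
  have hconf : ∀ q, gradInner g (fun x => (φ x).re) (fun x => (φ x).re) q -
      gradInner g (fun x => (φ x).im) (fun x => (φ x).im) q = (mu * φ q ^ 2).re ∧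
      gradInner g (fun x => (φ x).re) (fun x => (φ x).im) q = (mu * φ q ^ 2).im / 2 := by
    intro q
    have h := (hlm q).2
    rw [conformality, gradInner_comm g (fun x => (φ x).im) fun x => (φ x).re] at h
    rw [← h]
    constructor <;> simp
  have hsq : HasFDerivAt (fun y => mu * φ ((chartAt (Eu m) p).symm y) ^ 2)
      (0 : Eu m →L[ℝ] ℂ) (chartAt (Eu m) p p) := by
    have h := ((contDiffAt_comp_chartAt_symm hs ((chartAt (Eu m) p).map_source
      hps)).differentiableAt (by simp)).hasFDerivAt
    refine ((h.pow 2).const_mul mu).congr_fderiv ?_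
    simp only [Function.comp_apply, (chartAt (Eu m) p).left_inv hps, hp]
    ext v
    simp
  have h0 : mu * φ p ^ 2 = 0 := by simp [hp]
  -- `τ(φ) = lam φ`, and `κ(φ, φ) = mu φ²` with its first derivative, vanish at the zero `p` of `φ`
  refine meanCurvatureVanishesAt_of_horizontally_conformal g hk (K := φ ⁻¹' {0}) hp hre him
    (fun q hq => ?_) (fun q hq => ?_) hdiv.1 hdiv.2 ?_ ?_ ?_ ?_ ?_
  · simp [show φ q = 0 from hq]
  · simp [show φ q = 0 from hq]
  · intro h
    -- a vanishing gradient of `Re φ` would contradict the surjectivity of `dφ`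
    have hg : grad g (fun x => (φ x).re) p = 0 := by
      by_contra hne
      exact (g.pos p _ hne).ne' h
    obtain ⟨v, hv⟩ := h_reg p hp 1
    have h2 := mvfderiv_clm_comp Complex.reCLM (hs.mdifferentiable (by simp) p) v
    have h3 := inner_grad g (fun x => (φ x).re) p v
    rw [hg, map_zero] at h3
    have h4 := h3.trans h2
    rw [hv] at h4
    simp at h4
  · have h := (hconf p).1
    rw [h0] at h
    exact sub_eq_zero.1 h
  · rw [(hconf p).2, h0]
    simp
  · simp only [(hconf _).1]
    exact (Complex.reCLM.hasFDerivAt.comp _ hsq).congr_fderiv (by simp)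
  · simp only [(hconf _).2, div_eq_mul_inv]
    exact ((Complex.imCLM.hasFDerivAt.comp _ hsq).mul_const (2⁻¹ : ℝ)).congr_fderiv (by simp)

/-! ### Regular level sets -/

/-- A submersion `f` is turned into its differential `A` at `y` by a smooth local change of
coordinates near `y`. -/
theorem exists_straightening {E F : Type*} [NormedAddCommGroup E] [NormedSpace ℝ E]
    [CompleteSpace E] [NormedAddCommGroup F] [NormedSpace ℝ F] [FiniteDimensional ℝ F]
    {O : Set E} (hO : IsOpen O) {y : E} (hy : y ∈ O) {f : E → F} (hf : ContDiffOn ℝ ∞ f O)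
    (hsurj : Function.Surjective (fderiv ℝ f y)) :
    ∃ Ψ : OpenPartialHomeomorph E E, y ∈ Ψ.source ∧ Ψ.source ⊆ O ∧
      ContDiffOn ℝ ∞ Ψ Ψ.source ∧ ContDiffOn ℝ ∞ Ψ.symm Ψ.target ∧
      ∀ z, fderiv ℝ f y (Ψ z) = f z := by
  set A := fderiv ℝ f y with hA
  obtain ⟨R', hR'⟩ := A.toLinearMap.exists_rightInverse_of_surjective
    (LinearMap.range_eq_top.2 hsurj)
  let R : F →L[ℝ] E := LinearMap.toContinuousLinearMap R'
  have hR : ∀ a, A (R a) = a := fun a => LinearMap.congr_fun hR' a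
  -- the correction by the right inverse `R` makes `A ∘ ψ = f`, and it has derivative `R ∘ (A - A) = 0`
  -- at `y`, so that the derivative of `ψ` there is the identity
  let ψ : E → E := fun z => (z - y) + R (f z - A (z - y))
  have hAψ : ∀ z, A (ψ z) = f z := fun z => by simp [ψ, hR]
  have hψ : ContDiffOn ℝ ∞ ψ O := by
    refine (contDiffOn_id.sub contDiffOn_const).add (R.contDiff.comp_contDiffOn (hf.sub ?_))
    exact A.contDiff.comp_contDiffOn (contDiffOn_id.sub contDiffOn_const)
  have hψy : ContDiffAt ℝ ∞ ψ y := hψ.contDiffAt (hO.mem_nhds hy)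
  have hderiv : HasFDerivAt ψ ((ContinuousLinearEquiv.refl ℝ E : E ≃L[ℝ] E) : E →L[ℝ] E) y := by
    have h1 : HasFDerivAt f A y :=
      ((hf.contDiffAt (hO.mem_nhds hy)).differentiableAt (by simp)).hasFDerivAt
    have h2 : HasFDerivAt (fun z : E => z - y) (ContinuousLinearMap.id ℝ E) y :=
      (hasFDerivAt_id y).sub_const y
    have h3 := h2.add (R.hasFDerivAt.comp y (h1.sub (A.hasFDerivAt.comp y h2)))
    refine h3.congr_fderiv ?_
    ext v
    simp
  -- the inverse is smooth where the derivative of `ψ` is invertible, which is an open condition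
  have hopen : IsOpen (O ∩ fderiv ℝ ψ ⁻¹' range ((↑) : (E ≃L[ℝ] E) → E →L[ℝ] E)) :=
    (hψ.continuousOn_fderiv_of_isOpen hO (by simp)).isOpen_inter_preimage hO
      ContinuousLinearEquiv.isOpen
  let Ψ := (hψy.toOpenPartialHomeomorph ψ hderiv (by simp)).restrOpen _ hopen
  have hsrc : Ψ.source ⊆ O ∩ fderiv ℝ ψ ⁻¹' range ((↑) : (E ≃L[ℝ] E) → E →L[ℝ] E) :=
    fun z hz => hz.2
  refine ⟨Ψ, ⟨hψy.mem_toOpenPartialHomeomorph_source hderiv (by simp), hy, ?_⟩,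
    fun z hz => (hsrc hz).1, hψ.mono fun z hz => (hsrc hz).1, fun z hz => ?_, hAψ⟩
  · exact ⟨_, hderiv.fderiv.symm⟩
  · have hz' := hsrc (Ψ.map_target hz)
    obtain ⟨T, hT⟩ := hz'.2
    have hc := hψ.contDiffAt (hO.mem_nhds hz'.1)
    refine (Ψ.contDiffAt_symm (f₀' := T) hz ?_ hc).contDiffWithinAt
    rw [hT]
    exact (hc.differentiableAt (by simp)).hasFDerivAt

/-- The regular value theorem, for the fibre over `0` of a map to a vector space. -/
theorem isEmbeddedSubmanifold_of_surjective {F : Type*} [NormedAddCommGroup F] [NormedSpace ℝ F]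
    [FiniteDimensional ℝ F] {k : ℕ} (hk : k + Module.finrank ℝ F = m) {f : M → F}
    (hf : ContMDiff (𝓡 m) 𝓘(ℝ, F) ∞ f)
    (hsurj : ∀ p, f p = 0 → Function.Surjective (mvfderiv (𝓡 m) f p)) :
    IsEmbeddedSubmanifold (m := m) (f ⁻¹' {0}) k := by
  intro p hp
  have he := chartAt_mdifferentiable (m := m) p
  have hps := mem_chart_source (Eu m) p
  have hmax : chartAt (Eu m) p ∈ IsManifold.maximalAtlas (𝓡 m) ∞ M :=
    IsManifold.chart_mem_maximalAtlas p
  set e := chartAt (Eu m) p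
  have hA : Function.Surjective (fderiv ℝ (f ∘ e.symm) (e p)) := fun a => by
    obtain ⟨v, hv⟩ := hsurj p hp a
    rw [mvfderiv_eq_fderiv_comp_symm he hps (hf.mdifferentiable (by simp) p)] at hv
    exact ⟨_, hv⟩
  obtain ⟨Ψ, hpΨ, -, hΨ, hΨs, hfΨ⟩ := exists_straightening e.open_target (e.map_source hps)
    (fun y hy => (contDiffAt_comp_chartAt_symm hf hy).contDiffWithinAt) hA
  refine ⟨e.trans Ψ, ?_, ?_, (fderiv ℝ (f ∘ e.symm) (e p)).ker, ?_, fun x hx => ?_⟩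
  · refine OpenPartialHomeomorph.mem_maximalAtlas_of_contMDiffOn _ ?_ ?_
    · refine (contMDiffOn_iff_contDiffOn.2 hΨ).comp
        ((contMDiffOn_of_mem_maximalAtlas hmax).mono ?_) ?_
      · exact fun x hx => hx.1
      · exact fun x hx => hx.2
    · refine (contMDiffOn_symm_of_mem_maximalAtlas hmax).comp
        ((contMDiffOn_iff_contDiffOn.2 hΨs).mono ?_) ?_
      · exact fun x hx => hx.1
      · exact fun x hx => hx.2
  · exact ⟨hps, hpΨ⟩
  · have h := (fderiv ℝ (f ∘ e.symm) (e p)).toLinearMap.finrank_range_add_finrank_ker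
    rw [LinearMap.range_eq_top.2 hA, finrank_top, finrank_euclideanSpace_fin] at h
    have h' : Module.finrank ℝ (fderiv ℝ (f ∘ e.symm) (e p)).ker + Module.finrank ℝ F = m := by
      rw [add_comm]; exact h
    omega
  · rw [LinearMap.mem_ker]
    change f x = 0 ↔ fderiv ℝ (f ∘ e.symm) (e p) (Ψ (e x)) = 0
    rw [hfΨ, Function.comp_apply, e.left_inv hx.1]

end

theorem theorem1p3 {m : ℕ} {M : Type*} [TopologicalSpace M] [T2Space M]
    [ChartedSpace (Eu m) M] [IsManifold (𝓡 m) ∞ M] (g : SmoothMetric m M) (φ : M → ℂ)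
    (hφ : IsEigenfunction g φ) (h_mem : (0 : ℂ) ∈ Set.range φ)
    (h_reg : IsRegularValue (m := m) φ 0) :
    ∃ k : ℕ, k + 2 = m ∧ IsMinimalSubmanifold g k (φ ⁻¹' {0}) := by
  obtain ⟨p, hp⟩ := h_mem
  -- a surjection from the tangent space at `p` onto `ℂ` forces `2 ≤ m`
  have h2 : 2 ≤ m := by
    let A : Eu m →L[ℝ] ℂ := mvfderiv (𝓡 m) φ p
    have h := LinearMap.finrank_le_finrank_of_surjective (f := A.toLinearMap) (h_reg p hp)
    rwa [Complex.finrank_real_complex, finrank_euclideanSpace_fin] at h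
  obtain ⟨k, rfl⟩ := Nat.exists_eq_add_of_le' h2
  refine ⟨k, rfl, isEmbeddedSubmanifold_of_surjective (by simp) hφ.1 h_reg, fun q hq => ?_⟩
  exact meanCurvatureVanishesAt_of_eigenfunction g hφ h_reg rfl hq
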